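/- **Theorem.** Let $(R,\mathfrak m)$ be a Noetherian local ring and let $M$ be a finitely generated $R$-module of dimension $d\ge 1$ (the dimension of the support of $M$). Let $J=(x_1,\dots,x_d)$ be an ideal generated by a system of parameters for $M$, that is, $x_1,\dots,x_d\in\mathfrak m$ and the length $\lambda(M/JM)$ is finite. Then there are unique integers $e_0(J,M),\dots,e_d(J,M)$ such that for all sufficiently large $n$ the length $\lambda(M/J^nM)$ is finite and $$\lambda(M/J^nM)=\sum_{i=0}^{d}(-1)^i e_i(J,M)\binom{n+d-1-i}{d-i},$$ and the Chern number $e_1(J,M)$ satisfies $e_1(J,M)\le 0$. -/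

import Mathlib

open Polynomial Filter

/-- A sequence `x₁, …, x_d` in a local ring `R` is a system of parameters for the `R`-module `M`
if `d` is the dimension of `M`, all the `xᵢ` lie in the maximal ideal, and
`M / (x₁, …, x_d) M` has finite length. -/
structure IsSystemOfParameters {R : Type*} [CommRing R] [IsLocalRing R]
    (M : Type*) [AddCommGroup M] [Module R M] {d : ℕ} (x : Fin d → R) : Prop where
  dim_eq : Module.supportDim R M = d
  mem_maximalIdeal : ∀ i, x i ∈ IsLocalRing.maximalIdeal R
  length_ne_top :
    Module.length R (M ⧸ (Ideal.span (Set.range x) • ⊤ : Submodule R M)) ≠ ⊤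

/-- The Hilbert function `H_I(M, n) = λ(M / Iⁿ M)`. -/
noncomputable def hilbertFunction {R : Type*} [CommRing R] (I : Ideal R)
    (M : Type*) [AddCommGroup M] [Module R M] (n : ℕ) : ℕ∞ :=
  Module.length R (M ⧸ (I ^ n • ⊤ : Submodule R M))

/-- `P` is the Hilbert polynomial of `I` with respect to `M`: for all large `n`, the length
`λ(M / Iⁿ M)` is finite and equal to `P(n)`. -/
def IsHilbertPolynomial {R : Type*} [CommRing R] (I : Ideal R)
    (M : Type*) [AddCommGroup M] [Module R M] (P : ℚ[X]) : Prop :=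
  ∀ᶠ n : ℕ in atTop, ∃ l : ℕ, hilbertFunction I M n = l ∧ P.eval (n : ℚ) = l

/-- The polynomial `binom(x + k - 1, k) = x (x + 1) ⋯ (x + k - 1) / k!`. -/
noncomputable def risingBinomial (k : ℕ) : ℚ[X] :=
  C ((k.factorial : ℚ)⁻¹) * ascPochhammer ℚ k

/-- The integers `e₀, …, e_d` are the Hilbert coefficients of `I` with respect to the
`d`-dimensional module `M`: the Hilbert polynomial is
`∑ᵢ (-1)ⁱ eᵢ binom(x + d - i - 1, d - i)`. -/
def AreHilbertCoefficients {R : Type*} [CommRing R] (I : Ideal R)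
    (M : Type*) [AddCommGroup M] [Module R M] {d : ℕ} (e : Fin (d + 1) → ℤ) : Prop :=
  IsHilbertPolynomial I M
    (∑ i : Fin (d + 1), C ((-1 : ℚ) ^ (i : ℕ) * (e i : ℚ)) * risingBinomial (d - (i : ℕ)))

/-! ### Lengths and monomials -/

section Length

variable {R : Type*} [CommRing R] {M : Type*} [AddCommGroup M] [Module R M]

/-! Filter `JⁿM / Jⁿ⁺¹M` by adjoining the submodules `xᵃM`, `|a| = n`, in lexicographic order. The
successive quotients are `M / monomialColon M x a`, and these colon submodules grow with `a`
(`monomialColon_mono`). Hence `λ(M/JⁿM)` is the sum over `|a| < n` of an antitone function `l : ℕᵈ →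
ℕ`.

Let `l a₀` be the minimum of `l`. The constant `l a₀` contributes exactly `l a₀ * binom(n+d-1, d)`,
with no lower terms. The remainder `l - l a₀` is nonnegative, antitone and zero at `a₀`, so its sums
are polynomial of degree less than `d` (`isEventuallyBinomial_simplexSum`). They are nonnegative,
hence so is their coefficient in degree `d - 1`, which is `-e₁`
(`exists_simplexSum_eq_of_antitone`). -/

/-- The submodule `B + ∑_{b ∈ s} r_b M`. -/
def adjoinMultiples {ι : Type*} (B : Submodule R M) (r : ι → R) (s : Finset ι) : Submodule R M :=
  B ⊔ ⨆ b ∈ s, LinearMap.range (LinearMap.lsmul R M (r b))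

theorem adjoinMultiples_le {ι : Type*} {B N : Submodule R M} {r : ι → R} {s : Finset ι}
    (hB : B ≤ N) (hr : ∀ b ∈ s, ∀ m : M, r b • m ∈ N) : adjoinMultiples B r s ≤ N := by
  refine sup_le hB (iSup₂_le fun b hb => ?_)
  rintro _ ⟨m, rfl⟩
  exact hr b hb m

theorem base_le_adjoinMultiples {ι : Type*} (B : Submodule R M) (r : ι → R) (s : Finset ι) :
    B ≤ adjoinMultiples B r s :=
  le_sup_left

theorem smul_mem_adjoinMultiples {ι : Type*} (B : Submodule R M) (r : ι → R) {s : Finset ι}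
    {b : ι} (hb : b ∈ s) (m : M) : r b • m ∈ adjoinMultiples B r s :=
  (le_iSup₂_of_le (f := fun b (_ : b ∈ s) => LinearMap.range (LinearMap.lsmul R M (r b)))
    b hb le_rfl |>.trans le_sup_right) ⟨m, rfl⟩

/-- Additivity of length on `0 → M/f⁻¹N → M/N → M/(N + fM) → 0`. -/
theorem length_quotient_eq_comap_add (N : Submodule R M) (f : M →ₗ[R] M) :
    Module.length R (M ⧸ N) =
      Module.length R (M ⧸ N.comap f) + Module.length R (M ⧸ N ⊔ LinearMap.range f) := by
  refine Module.length_eq_add_of_exact (Submodule.mapQ (N.comap f) N f le_rfl)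
    (Submodule.factor (le_sup_left : N ≤ N ⊔ LinearMap.range f)) ?_
    (Submodule.factor_surjective _) ?_
  · rw [← LinearMap.ker_eq_bot, Submodule.mapQ, Submodule.ker_liftQ_eq_bot]
    rw [LinearMap.ker_comp, Submodule.ker_mkQ]
  · rw [LinearMap.exact_iff]
    ext y
    obtain ⟨y, rfl⟩ := Submodule.Quotient.mk_surjective _ y
    constructor
    · intro hy
      have hy : y ∈ N ⊔ LinearMap.range f := by simpa using hy
      obtain ⟨n, hn, _, ⟨m, rfl⟩, rfl⟩ := Submodule.mem_sup.1 hy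
      refine ⟨Submodule.Quotient.mk m, ?_⟩
      simp only [Submodule.mapQ_apply]
      rw [Submodule.Quotient.eq]
      simpa using hn
    · rintro ⟨m, hm⟩
      obtain ⟨m, rfl⟩ := Submodule.Quotient.mk_surjective _ m
      rw [← hm]
      simpa using Submodule.mem_sup_right (LinearMap.mem_range_self f m)

theorem length_quotient_eq_sum_comap {ι : Type*} [LinearOrder ι] (B : Submodule R M) (r : ι → R)
    (s : Finset ι) :
    Module.length R (M ⧸ B) =
      ∑ a ∈ s, Module.length R
          (M ⧸ (adjoinMultiples B r {b ∈ s | b < a}).comap (LinearMap.lsmul R M (r a))) +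
        Module.length R (M ⧸ adjoinMultiples B r s) := by
  induction s using Finset.induction_on_max with
  | empty =>
    have h : adjoinMultiples B r ∅ = B :=
      le_antisymm (adjoinMultiples_le le_rfl (by simp)) (base_le_adjoinMultiples _ _ _)
    rw [h, Finset.sum_empty, zero_add]
  | insert a s ha ih =>
    have hs : a ∉ s := fun h => lt_irrefl _ (ha a h)
    have h1 : ({b ∈ insert a s | b < a} : Finset ι) = s := by
      ext b
      simp only [Finset.mem_filter, Finset.mem_insert]
      exact ⟨fun h => h.1.resolve_left h.2.ne, fun h => ⟨Or.inr h, ha b h⟩⟩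
    have h2 : ∀ c ∈ s, ({b ∈ insert a s | b < c} : Finset ι) = {b ∈ s | b < c} := by
      intro c hc
      rw [Finset.filter_insert, if_neg (ha c hc).not_gt]
    have h3 : adjoinMultiples B r (insert a s) =
        adjoinMultiples B r s ⊔ LinearMap.range (LinearMap.lsmul R M (r a)) := by
      rw [adjoinMultiples, adjoinMultiples, Finset.iSup_insert, sup_assoc, sup_comm (LinearMap.range _)]
    rw [ih, Finset.sum_insert hs, h1, h3,
      length_quotient_eq_comap_add _ (LinearMap.lsmul R M (r a)),
      Finset.sum_congr rfl fun c hc => by rw [← h2 c hc]]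
    abel

/-- The monomial `∏ᵢ xᵢ ^ aᵢ`. -/
def powProd {d : ℕ} (x : Fin d → R) (a : Fin d → ℕ) : R := ∏ i, x i ^ a i

theorem powProd_add {d : ℕ} (x : Fin d → R) (a b : Fin d → ℕ) :
    powProd x (a + b) = powProd x a * powProd x b := by
  simp [powProd, pow_add, Finset.prod_mul_distrib]

theorem powProd_single {d : ℕ} (x : Fin d → R) (i : Fin d) :
    powProd x (Pi.single i 1) = x i := by
  rw [powProd, Finset.prod_eq_single i] <;> simp +contextual

theorem powProd_mem_pow {d : ℕ} (x : Fin d → R) (a : Fin d → ℕ) :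
    powProd x a ∈ Ideal.span (Set.range x) ^ ∑ i, a i := by
  rw [powProd, ← Finset.prod_pow_eq_pow_sum]
  exact Ideal.prod_mem_prod fun i _ =>
    Ideal.pow_mem_pow (Ideal.subset_span (Set.mem_range_self i)) _

theorem span_range_pow_le {d : ℕ} (x : Fin d → R) (n : ℕ) :
    Ideal.span (Set.range x) ^ n ≤
      Ideal.span (powProd x '' {a : Fin d → ℕ | ∑ i, a i = n}) := by
  induction n with
  | zero =>
    rw [pow_zero, Ideal.one_eq_top, top_le_iff, Ideal.eq_top_iff_one]
    exact Ideal.subset_span ⟨0, by simp, by simp [powProd]⟩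
  | succ n ih =>
    rw [pow_succ]
    refine (Ideal.mul_mono_left ih).trans ?_
    rw [Ideal.span_mul_span', Ideal.span_le]
    rintro _ ⟨_, ⟨a, ha, rfl⟩, _, ⟨i, rfl⟩, rfl⟩
    refine Ideal.subset_span ⟨a + Pi.single i 1, ?_, ?_⟩
    · have ha : ∑ i, a i = n := ha
      simp [Finset.sum_add_distrib, ha]
    · rw [powProd_add, powProd_single]

open scoped Classical in
/-- The submodule `{m | xᵃ m ∈ Jⁿ⁺¹ M + ∑_{b < a, |b| = n} xᵇ M}` for `J = (x)` and `n = |a|`,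
with respect to the lexicographic order. -/
noncomputable def monomialColon (M : Type*) [AddCommGroup M] [Module R M] {d : ℕ} (x : Fin d → R)
    (a : Fin d → ℕ) : Submodule R M :=
  (adjoinMultiples (Ideal.span (Set.range x) ^ (∑ i, a i + 1) • ⊤ : Submodule R M)
    (fun b => powProd x (ofLex b))
    (((Finset.Nat.antidiagonalTuple d (∑ i, a i)).map toLex.toEmbedding).filter
      fun b : Lex (Fin d → ℕ) => b < toLex a)).comap
    (LinearMap.lsmul R M (powProd x a))

/-- Bounds every `λ(M / monomialColon M x a)` by `λ(M/JM)`, hence makes it finite. -/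
theorem span_smul_top_le_monomialColon {d : ℕ} (x : Fin d → R) (a : Fin d → ℕ) :
    (Ideal.span (Set.range x) • ⊤ : Submodule R M) ≤ monomialColon M x a := by
  rw [Submodule.smul_le]
  intro r hr m _
  refine base_le_adjoinMultiples _ _ _ ?_
  rw [LinearMap.lsmul_apply, smul_smul, pow_succ]
  exact Submodule.smul_mem_smul (Ideal.mul_mem_mul (powProd_mem_pow x a) hr) trivial

/-- Multiplication by `xᶜ` carries the submodule defining one colon into the one defining the other,
since the lexicographic order is translation invariant. -/
theorem monomialColon_mono {d : ℕ} (x : Fin d → R) : Monotone (monomialColon M x) := by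
  classical
  intro a b hab m hm
  obtain ⟨c, rfl⟩ := exists_add_of_le hab
  rw [monomialColon, Submodule.mem_comap, LinearMap.lsmul_apply] at hm ⊢
  rw [add_comm a c, powProd_add, mul_smul, ← LinearMap.lsmul_apply (powProd x c),
    ← Submodule.mem_comap]
  revert hm
  apply adjoinMultiples_le
  · intro y hy
    refine base_le_adjoinMultiples _ _ _ ?_
    have : ∑ i, (c + a) i + 1 = ∑ i, c i + (∑ i, a i + 1) := by
      simp [Finset.sum_add_distrib, add_assoc]
    rw [this, pow_add, mul_smul]
    exact Submodule.smul_mem_smul (powProd_mem_pow x c) hy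
  · intro b hb y
    obtain ⟨hb, hlt⟩ := Finset.mem_filter.1 hb
    obtain ⟨b, hb', rfl⟩ := Finset.mem_map.1 hb
    replace hb := Finset.Nat.mem_antidiagonalTuple.1 hb'
    rw [Submodule.mem_comap, LinearMap.lsmul_apply, smul_smul]
    have : powProd x c * powProd x (ofLex (toLex.toEmbedding b)) =
      powProd x (ofLex (toLex (c + b))) := (powProd_add x c b).symm
    rw [this]
    refine smul_mem_adjoinMultiples _ (fun b => powProd x (ofLex b)) ?_ _
    refine Finset.mem_filter.2 ⟨Finset.mem_map.2 ⟨c + b, ?_, rfl⟩, ?_⟩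
    · rw [Finset.Nat.mem_antidiagonalTuple]
      simp [Finset.sum_add_distrib, hb]
    · exact add_lt_add_right hlt (toLex c)

theorem adjoinMultiples_antidiagonalTuple {d : ℕ} (x : Fin d → R) (n : ℕ) :
    adjoinMultiples (Ideal.span (Set.range x) ^ (n + 1) • ⊤ : Submodule R M)
      (fun b => powProd x (ofLex b)) ((Finset.Nat.antidiagonalTuple d n).map toLex.toEmbedding) =
      Ideal.span (Set.range x) ^ n • ⊤ := by
  apply le_antisymm
  · apply adjoinMultiples_le
    · exact Submodule.smul_mono_left (Ideal.pow_le_pow_right n.le_succ)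
    · intro b hb m
      obtain ⟨b, hb', rfl⟩ := Finset.mem_map.1 hb
      replace hb := Finset.Nat.mem_antidiagonalTuple.1 hb'
      exact Submodule.smul_mem_smul (hb ▸ powProd_mem_pow x b) trivial
  · refine (Submodule.smul_mono_left (span_range_pow_le x n)).trans ?_
    rw [Submodule.smul_le]
    intro r hr m _
    induction hr using Submodule.span_induction with
    | mem r hr =>
      obtain ⟨a, ha, rfl⟩ := hr
      exact smul_mem_adjoinMultiples _ (fun b => powProd x (ofLex b)) (b := toLex a)
        (Finset.mem_map.2 ⟨a, Finset.Nat.mem_antidiagonalTuple.2 ha, rfl⟩) m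
    | zero => simp
    | add r s _ _ hr hs => rw [add_smul]; exact add_mem hr hs
    | smul t r _ hr => rw [smul_assoc]; exact Submodule.smul_mem _ _ hr

theorem hilbertFunction_succ {d : ℕ} (x : Fin d → R) (n : ℕ) :
    hilbertFunction (Ideal.span (Set.range x)) M (n + 1) =
      ∑ a ∈ Finset.Nat.antidiagonalTuple d n, Module.length R (M ⧸ monomialColon M x a) +
        hilbertFunction (Ideal.span (Set.range x)) M n := by
  rw [hilbertFunction, hilbertFunction, length_quotient_eq_sum_comap _
    (fun b => powProd x (ofLex b)) ((Finset.Nat.antidiagonalTuple d n).map toLex.toEmbedding),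
    adjoinMultiples_antidiagonalTuple, Finset.sum_map]
  congr 1
  refine Finset.sum_congr rfl fun a ha => ?_
  rw [Finset.Nat.mem_antidiagonalTuple] at ha
  subst ha
  unfold monomialColon
  congr!

theorem exists_antitone_hilbertFunction_eq_sum {d : ℕ} (x : Fin d → R)
    (hx : Module.length R (M ⧸ (Ideal.span (Set.range x) • ⊤ : Submodule R M)) ≠ ⊤) :
    ∃ l : (Fin d → ℕ) → ℕ, Antitone l ∧ ∀ n, hilbertFunction (Ideal.span (Set.range x)) M n =
      (∑ m ∈ Finset.range n, ∑ a ∈ Finset.Nat.antidiagonalTuple d m, l a : ℕ) := by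
  have hle {N N' : Submodule R M} (h : N ≤ N') :
      Module.length R (M ⧸ N') ≤ Module.length R (M ⧸ N) :=
    Module.length_le_of_surjective (Submodule.factor h) (Submodule.factor_surjective h)
  have hfin (a) : Module.length R (M ⧸ monomialColon M x a) ≠ ⊤ :=
    ne_top_of_le_ne_top hx (hle (span_smul_top_le_monomialColon x a))
  refine ⟨fun a => (Module.length R (M ⧸ monomialColon M x a)).toNat, fun a b hab =>
    ENat.toNat_le_toNat (hle (monomialColon_mono x hab)) (hfin a), fun n => ?_⟩
  induction n with
  | zero =>
    have : Subsingleton (M ⧸ (Ideal.span (Set.range x) ^ 0 • ⊤ : Submodule R M)) := by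
      rw [Submodule.Quotient.subsingleton_iff]
      simp
    simp [hilbertFunction, Module.length_eq_zero]
  | succ n ih =>
    rw [hilbertFunction_succ, ih, Finset.sum_range_succ, Nat.cast_add, add_comm, Nat.cast_sum _ _]
    congr 1
    rw [Nat.cast_sum]
    exact Finset.sum_congr rfl fun a _ => (ENat.natCast_toNat (hfin a)).symm

end Length

/-! ### Numerical functions of polynomial type -/

section Numerical

/-- `f` is eventually an integral combination of the functions `n ↦ binom(n + k - 1, k)`
with `k < d`. -/
def IsEventuallyBinomial (d : ℕ) (f : ℕ → ℤ) : Prop :=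
  ∃ c : ℕ → ℤ, ∀ᶠ n : ℕ in atTop, f n = ∑ k ∈ Finset.range d, c k * (n.multichoose k : ℤ)

namespace IsEventuallyBinomial

variable {d : ℕ} {f g : ℕ → ℤ}

theorem congr' (hf : IsEventuallyBinomial d f) (h : ∀ᶠ n in atTop, g n = f n) :
    IsEventuallyBinomial d g := by
  obtain ⟨c, hc⟩ := hf
  exact ⟨c, by filter_upwards [hc, h] with n h1 h2 using h2.trans h1⟩

theorem add (hf : IsEventuallyBinomial d f) (hg : IsEventuallyBinomial d g) :
    IsEventuallyBinomial d fun n => f n + g n := by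
  obtain ⟨c, hc⟩ := hf
  obtain ⟨b, hb⟩ := hg
  refine ⟨fun k => c k + b k, ?_⟩
  filter_upwards [hc, hb] with n h1 h2
  rw [h1, h2, ← Finset.sum_add_distrib]
  exact Finset.sum_congr rfl fun k _ => by ring

theorem sub (hf : IsEventuallyBinomial d f) (hg : IsEventuallyBinomial d g) :
    IsEventuallyBinomial d fun n => f n - g n := by
  obtain ⟨c, hc⟩ := hf
  obtain ⟨b, hb⟩ := hg
  refine ⟨fun k => c k - b k, ?_⟩
  filter_upwards [hc, hb] with n h1 h2
  rw [h1, h2, ← Finset.sum_sub_distrib]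
  exact Finset.sum_congr rfl fun k _ => by ring

theorem zero (d : ℕ) : IsEventuallyBinomial d fun _ => 0 :=
  ⟨fun _ => 0, by simp⟩

theorem sum {s : Finset ℕ} {F : ℕ → ℕ → ℤ} (h : ∀ j ∈ s, IsEventuallyBinomial d (F j)) :
    IsEventuallyBinomial d fun n => ∑ j ∈ s, F j n := by
  induction s using Finset.induction_on with
  | empty => simpa using zero d
  | insert j s hj ih =>
    simp only [Finset.sum_insert hj]
    exact (h j (by simp)).add (ih fun i hi => h i (by simp [hi]))

theorem mono {e : ℕ} (hf : IsEventuallyBinomial d f) (hde : d ≤ e) :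
    IsEventuallyBinomial e f := by
  obtain ⟨c, hc⟩ := hf
  refine ⟨fun k => if k < d then c k else 0, ?_⟩
  filter_upwards [hc] with n h
  rw [h, ← Finset.sum_subset (Finset.range_mono hde)]
  · exact Finset.sum_congr rfl fun k hk => by rw [if_pos (Finset.mem_range.1 hk)]
  · intro k _ hk
    rw [if_neg (by simpa using hk), zero_mul]

/-- By Pascal's rule `f n - f (n - 1)` is a combination of the same kind, with indices lowered by
one. -/
theorem pred (hf : IsEventuallyBinomial d f) : IsEventuallyBinomial d fun n => f (n - 1) := by
  rcases d with _ | d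
  · obtain ⟨c, hc⟩ := hf
    exact ⟨c, by simpa using (tendsto_sub_atTop_nat 1).eventually hc⟩
  obtain ⟨c, hc⟩ := hf
  have hg : IsEventuallyBinomial (d + 1)
      fun n => ∑ k ∈ Finset.range d, c (k + 1) * (n.multichoose k : ℤ) :=
    mono (d := d) ⟨fun k => c (k + 1), by simp⟩ d.le_succ
  refine (sub ⟨c, hc⟩ hg).congr' ?_
  filter_upwards [hc, (tendsto_sub_atTop_nat 1).eventually hc, eventually_ge_atTop 1] with n h h' hn
  rw [h, h', Finset.sum_range_succ', Finset.sum_range_succ', add_sub_right_comm,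
    ← Finset.sum_sub_distrib]
  obtain ⟨m, rfl⟩ := Nat.exists_eq_add_of_le' hn
  simp only [Nat.add_sub_cancel, Nat.multichoose_zero_right]
  congr 1
  refine Finset.sum_congr rfl fun k _ => ?_
  rw [Nat.multichoose_succ_succ]
  push_cast
  ring

theorem shift (hf : IsEventuallyBinomial d f) (j : ℕ) :
    IsEventuallyBinomial d fun n => f (n - j) := by
  induction j with
  | zero => simpa using hf
  | succ j ih => exact ih.pred.congr' (Eventually.of_forall fun n => by congr 1; omega)

theorem sum_range (hf : IsEventuallyBinomial d f) :
    IsEventuallyBinomial (d + 1) fun n => ∑ i ∈ Finset.range n, f (i + 1) := by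
  obtain ⟨c, hc⟩ := hf
  obtain ⟨N, hN⟩ := eventually_atTop.1 hc
  set S : ℕ → ℤ := fun n => ∑ k ∈ Finset.range d, c k * (n.multichoose (k + 1) : ℤ) with hS
  -- Summation raises each index by one; the new constant term absorbs the discrepancy accumulated
  -- before `N`.
  refine ⟨fun k => Nat.casesOn k (∑ i ∈ Finset.range N, f (i + 1) - S N) c, ?_⟩
  filter_upwards [eventually_ge_atTop N] with n hn
  rw [Finset.sum_range_succ']
  change _ = S n + _
  simp only [Nat.multichoose_zero_right, Nat.cast_one, mul_one]
  induction n, hn using Nat.le_induction with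
  | base => exact (add_sub_cancel _ _).symm
  | succ n hn ih =>
    have : S (n + 1) = S n + f (n + 1) := by
      rw [hN (n + 1) (by omega), hS]
      simp only
      rw [← Finset.sum_add_distrib]
      refine Finset.sum_congr rfl fun k _ => ?_
      rw [Nat.multichoose_succ_succ]
      push_cast
      ring
    rw [Finset.sum_range_succ, ih, this]
    ring

end IsEventuallyBinomial

/-- The difference of the sum has the same leading coefficient in one degree less, so by induction
the sum eventually drops by at least one at each step. -/
theorem eventually_sum_multichoose_neg {d : ℕ} {c : ℕ → ℤ} (hc : c d < 0) :
    ∀ᶠ n : ℕ in atTop, ∑ k ∈ Finset.range (d + 1), c k * (n.multichoose k : ℤ) < 0 := by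
  induction d generalizing c with
  | zero => exact Eventually.of_forall fun n => by simpa using hc
  | succ d ih =>
    obtain ⟨N, hN⟩ := eventually_atTop.1 (ih (c := fun k => c (k + 1)) hc)
    set S : ℕ → ℤ := fun n => ∑ k ∈ Finset.range (d + 2), c k * (n.multichoose k : ℤ) with hS
    have hstep (n : ℕ) (hn : N ≤ n) : S (n + 1) + 1 ≤ S n := by
      have h := hN (n + 1) (by omega)
      have : S (n + 1) = S n +
          ∑ k ∈ Finset.range (d + 1), c (k + 1) * ((n + 1).multichoose k : ℤ) := by
        simp only [hS]
        rw [Finset.sum_range_succ' _ (d + 1), Finset.sum_range_succ' _ (d + 1), add_right_comm,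
          ← Finset.sum_add_distrib]
        simp only [Nat.multichoose_zero_right]
        congr 1
        refine Finset.sum_congr rfl fun k _ => ?_
        rw [Nat.multichoose_succ_succ]
        push_cast
        ring
      omega
    have hdesc (m : ℕ) : S (N + m) + m ≤ S N := by
      induction m with
      | zero => simp
      | succ m ihm =>
        have := hstep (N + m) (by omega)
        rw [← add_assoc]
        push_cast
        omega
    filter_upwards [eventually_ge_atTop (N + (S N).toNat + 1)] with n hn
    have := hdesc (n - N)
    rw [Nat.add_sub_cancel' (by omega)] at this
    change S n < 0
    omega

theorem nonneg_of_eventually_sum_multichoose_nonneg {d : ℕ} {c : ℕ → ℤ}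
    (h : ∀ᶠ n : ℕ in atTop, 0 ≤ ∑ k ∈ Finset.range (d + 1), c k * (n.multichoose k : ℤ)) :
    0 ≤ c d := by
  by_contra! hc
  obtain ⟨n, h1, h2⟩ := (h.and (eventually_sum_multichoose_neg hc)).exists
  exact h1.not_gt h2

theorem eq_zero_of_eventually_sum_multichoose_eq_zero {d : ℕ} {c : ℕ → ℤ}
    (h : ∀ᶠ n : ℕ in atTop, ∑ k ∈ Finset.range d, c k * (n.multichoose k : ℤ) = 0) :
    ∀ k < d, c k = 0 := by
  induction d with
  | zero => simp
  | succ d ih =>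
    have h1 := nonneg_of_eventually_sum_multichoose_nonneg (h.mono fun n hn => hn.ge)
    have h2 := nonneg_of_eventually_sum_multichoose_nonneg (d := d) (c := fun k => -c k)
      (h.mono fun n hn => by simp [hn])
    have hd : c d = 0 := by omega
    intro k hk
    rcases Nat.lt_succ_iff_lt_or_eq.1 hk with hk | rfl
    · exact ih (h.mono fun n hn => by simpa [Finset.sum_range_succ, hd] using hn) k hk
    · exact hd

theorem eventually_sum_multichoose_injective {d : ℕ} {f : ℕ → ℤ} {b c : ℕ → ℤ}
    (hb : ∀ᶠ n : ℕ in atTop, f n = ∑ k ∈ Finset.range d, b k * (n.multichoose k : ℤ))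
    (hc : ∀ᶠ n : ℕ in atTop, f n = ∑ k ∈ Finset.range d, c k * (n.multichoose k : ℤ)) :
    ∀ k < d, b k = c k := by
  intro k hk
  refine sub_eq_zero.1
    (eq_zero_of_eventually_sum_multichoose_eq_zero (c := fun k => b k - c k) (d := d) ?_ k hk)
  filter_upwards [hb, hc] with n h1 h2
  simp only [sub_mul, Finset.sum_sub_distrib]
  rw [← h1, ← h2, sub_self]

end Numerical

/-! ### Sums of antitone functions on `ℕᵈ` -/

section Antitone

/-- The sum of `l` over the points of `ℕᵈ` of degree less than `n`. -/
def simplexSum {d : ℕ} (l : (Fin d → ℕ) → ℤ) (n : ℕ) : ℤ :=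
  ∑ m ∈ Finset.range n, ∑ a ∈ Finset.Nat.antidiagonalTuple d m, l a

theorem simplexSum_nonneg {d : ℕ} {l : (Fin d → ℕ) → ℤ} (hl : ∀ a, 0 ≤ l a) (n : ℕ) :
    0 ≤ simplexSum l n :=
  Finset.sum_nonneg fun _ _ => Finset.sum_nonneg fun a _ => hl a

theorem simplexSum_zero {l : (Fin 0 → ℕ) → ℤ} (n : ℕ) : simplexSum l (n + 1) = l 0 := by
  rw [simplexSum, Finset.sum_range_succ']
  simp [Finset.Nat.antidiagonalTuple_zero_right]

theorem sum_antidiagonalTuple_succ {d : ℕ} (l : (Fin (d + 1) → ℕ) → ℤ) (m : ℕ) :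
    ∑ a ∈ Finset.Nat.antidiagonalTuple (d + 1) m, l a =
      ∑ j ∈ Finset.range (m + 1), ∑ a ∈ Finset.Nat.antidiagonalTuple d (m - j),
        l (Fin.cons j a) := by
  rw [Finset.sum_sigma']
  refine (Finset.sum_bij' (fun p _ => Fin.cons p.1 p.2) (fun a _ => ⟨a 0, Fin.tail a⟩)
    ?_ ?_ ?_ ?_ ?_).symm
  · rintro ⟨j, a⟩ h
    simp only [Finset.mem_sigma, Finset.mem_range, Finset.Nat.mem_antidiagonalTuple] at h
    rw [Finset.Nat.mem_antidiagonalTuple, Fin.sum_univ_succ]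
    simp only [Fin.cons_zero, Fin.cons_succ]
    omega
  · intro a h
    rw [Finset.Nat.mem_antidiagonalTuple, Fin.sum_univ_succ] at h
    simp only [Finset.mem_sigma, Finset.mem_range, Finset.Nat.mem_antidiagonalTuple, Fin.tail]
    omega
  · rintro ⟨j, a⟩ _
    simp
  · intro a _
    simp
  · intros
    rfl

theorem simplexSum_succ {d : ℕ} (l : (Fin (d + 1) → ℕ) → ℤ) (n : ℕ) :
    simplexSum l n = ∑ j ∈ Finset.range n, simplexSum (fun a => l (Fin.cons j a)) (n - j) := by
  simp only [simplexSum, sum_antidiagonalTuple_succ]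
  exact Finset.sum_range_diag_flip n fun j i =>
    ∑ a ∈ Finset.Nat.antidiagonalTuple d i, l (Fin.cons j a)

/-- Otherwise slices drop infinitely often. Among the pairs (value after the drop, position),
well-quasi-ordering gives an earlier pair below a later one, but antitonicity makes the later value
strictly smaller. -/
theorem exists_slice_eq_of_antitone {d : ℕ} {l : (Fin (d + 1) → ℕ) → ℤ} (hl : Antitone l)
    (h0 : ∀ a, 0 ≤ l a) :
    ∃ N, ∀ j, N ≤ j → ∀ a : Fin d → ℕ, l (Fin.cons j a) = l (Fin.cons N a) := by
  by_contra! hcon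
  choose j hj a ha using hcon
  have hanti {i i' : ℕ} {b b' : Fin d → ℕ} (h : i ≤ i') (h' : b ≤ b') :
      l (Fin.cons i' b') ≤ l (Fin.cons i b) := hl (Fin.cons_le_cons.2 ⟨h, h'⟩)
  have hlt (N : ℕ) : l (Fin.cons (j N) (a N)) < l (Fin.cons N (a N)) :=
    lt_of_le_of_ne (hanti (hj N) le_rfl) (ha N)
  let u : ℕ → ℕ := fun k => j^[k] 0
  have hu (k : ℕ) : u (k + 1) = j (u k) := Function.iterate_succ_apply' j k 0
  have hmono : Monotone u := monotone_nat_of_le_succ fun k => (hu k).symm ▸ hj _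
  obtain ⟨p, q, hpq, hle⟩ := wellQuasiOrdered_le
    (fun k => ((l (Fin.cons (j (u k)) (a (u k)))).toNat, a (u k)))
  obtain ⟨h1, h2⟩ := Prod.mk_le_mk.1 hle
  have h3 := hlt (u q)
  have h4 : l (Fin.cons (u q) (a (u q))) ≤ l (Fin.cons (j (u p)) (a (u p))) :=
    hanti (hu p ▸ hmono hpq) h2
  have h5 := h0 (Fin.cons (j (u q)) (a (u q)))
  omega

/-- Slice along the first coordinate: finitely many slices, already of lower degree, precede a
stable one that is summed repeatedly. A zero of `l` forces a zero of the stable slice, which lowers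
its degree by induction. -/
theorem isEventuallyBinomial_simplexSum {d : ℕ} {l : (Fin d → ℕ) → ℤ} (hl : Antitone l)
    (h0 : ∀ a, 0 ≤ l a) :
    IsEventuallyBinomial (d + 1) (simplexSum l) ∧
      ((∃ a, l a = 0) → IsEventuallyBinomial d (simplexSum l)) := by
  induction d with
  | zero =>
    have h : ∀ᶠ n in atTop, simplexSum l n = l 0 := by
      filter_upwards [eventually_ge_atTop 1] with n hn
      obtain ⟨m, rfl⟩ := Nat.exists_eq_add_of_le' hn
      exact simplexSum_zero m
    refine ⟨⟨fun _ => l 0, by simpa using h⟩, fun ⟨a, ha⟩ => ⟨fun _ => 0, ?_⟩⟩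
    rw [Subsingleton.elim a 0] at ha
    filter_upwards [h] with n hn
    rw [hn, ha, Finset.sum_range_zero]
  | succ d ih =>
    have hslice (j : ℕ) := ih (l := fun a => l (Fin.cons j a))
      (fun a b hab => hl (Fin.cons_le_cons.2 ⟨le_rfl, hab⟩)) (fun a => h0 _)
    obtain ⟨N, hN⟩ := exists_slice_eq_of_antitone hl h0
    have hdec : ∀ᶠ n in atTop, simplexSum l n =
        ∑ j ∈ Finset.range N, simplexSum (fun a => l (Fin.cons j a)) (n - j) +
          ∑ i ∈ Finset.range (n - N), simplexSum (fun a => l (Fin.cons N a)) (i + 1) := by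
      filter_upwards [eventually_ge_atTop N] with n hn
      obtain ⟨m, rfl⟩ := Nat.exists_eq_add_of_le hn
      rw [simplexSum_succ, Finset.sum_range_add, Nat.add_sub_cancel_left]
      congr 1
      -- After reflection the stable slices have sizes `1, …, n - N`, the form needed by
      -- `sum_range`.
      rw [← Finset.sum_range_reflect]
      refine Finset.sum_congr rfl fun i hi => ?_
      rw [Finset.mem_range] at hi
      congr 1
      · funext a
        exact hN _ (by omega) a
      · omega
    have hhead : IsEventuallyBinomial (d + 1) fun n =>
        ∑ j ∈ Finset.range N, simplexSum (fun a => l (Fin.cons j a)) (n - j) :=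
      IsEventuallyBinomial.sum fun j _ => (hslice j).1.shift j
    refine ⟨((hhead.mono (d + 1).le_succ).add ((hslice N).1.sum_range.shift N)).congr' hdec,
      fun ⟨a, ha⟩ => (hhead.add (((hslice N).2 ⟨Fin.tail a, ?_⟩).sum_range.shift N)).congr' hdec⟩
    refine le_antisymm ?_ (h0 _)
    -- The slice at `max N (a 0)` is stable and lies beyond `a`.
    rw [← hN (max N (a 0)) (le_max_left _ _), ← ha]
    apply hl
    conv_lhs => rw [← Fin.cons_self_tail a]
    exact Fin.cons_le_cons.2 ⟨le_max_right _ _, le_rfl⟩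

/-- Counts lattice points in a simplex. The argument is `n + 1` because at `0` with `d = 0` the sum
is empty while `multichoose` is `1`. -/
theorem simplexSum_const {d : ℕ} (c : ℤ) (n : ℕ) :
    simplexSum (fun _ : Fin d → ℕ => c) (n + 1) = c * ((n + 1).multichoose d : ℤ) := by
  induction d generalizing n with
  | zero => simp [simplexSum_zero]
  | succ d ih =>
    rw [simplexSum_succ, ← Finset.sum_range_reflect]
    have h (i : ℕ) (hi : i ∈ Finset.range (n + 1)) :
        simplexSum (fun _ : Fin d → ℕ => c) (n + 1 - (n + 1 - 1 - i)) =
          c * ((i + 1).multichoose d : ℤ) := by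
      rw [← ih]
      congr 1
      have := Finset.mem_range.1 hi
      omega
    rw [Finset.sum_congr rfl h, ← Finset.mul_sum]
    congr 1
    induction n + 1 with
    | zero => simp
    | succ m ihm =>
      rw [Finset.sum_range_succ, ihm, Nat.multichoose_succ_succ]
      push_cast
      ring

theorem exists_simplexSum_eq_of_antitone {d : ℕ} {l : (Fin (d + 1) → ℕ) → ℤ} (hl : Antitone l)
    (h0 : ∀ a, 0 ≤ l a) :
    ∃ c : ℕ → ℤ, 0 ≤ c d ∧ ∀ᶠ n : ℕ in atTop,
      simplexSum l n = ∑ k ∈ Finset.range (d + 2), c k * (n.multichoose k : ℤ) := by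
  obtain ⟨a₀, ha₀⟩ : ∃ a₀, ∀ a, l a₀ ≤ l a := by
    refine ⟨Function.argmin (fun a => (l a).toNat), fun a => ?_⟩
    have := Function.argmin_le (fun a => (l a).toNat) a
    have := h0 a
    have := h0 (Function.argmin (fun a => (l a).toNat))
    omega
  have hnonneg (a) : 0 ≤ l a - l a₀ := sub_nonneg.2 (ha₀ a)
  -- The zero at `a₀` makes `c d` the top coefficient of a nonnegative function.
  obtain ⟨c, hc⟩ := (isEventuallyBinomial_simplexSum (l := fun a => l a - l a₀)
    (fun a b hab => sub_le_sub_right (hl hab) _) hnonneg).2 ⟨a₀, sub_self _⟩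
  refine ⟨Function.update c (d + 1) (l a₀), ?_, ?_⟩
  · rw [Function.update_of_ne (by omega)]
    exact nonneg_of_eventually_sum_multichoose_nonneg
      (hc.mono fun n hn => hn ▸ simplexSum_nonneg hnonneg n)
  · filter_upwards [hc, eventually_ge_atTop 1] with n hn h1
    rw [Finset.sum_range_succ, Function.update_self, Finset.sum_congr rfl fun k hk => by
      rw [Function.update_of_ne (Finset.mem_range.1 hk).ne], ← hn]
    obtain ⟨m, rfl⟩ := Nat.exists_eq_add_of_le' h1
    rw [← simplexSum_const]
    simp [simplexSum, Finset.sum_sub_distrib]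

end Antitone

/-! ### Hilbert coefficients -/

section HilbertCoefficients

theorem risingBinomial_eval_natCast (k n : ℕ) :
    (risingBinomial k).eval (n : ℚ) = (n.multichoose k : ℚ) := by
  rw [risingBinomial, eval_mul, eval_C, ← ascPochhammer_eval_cast,
    ascPochhammer_nat_eq_ascFactorial, Nat.ascFactorial_eq_factorial_mul_choose',
    Nat.multichoose_eq, Nat.cast_mul, inv_mul_cancel_left₀ (by positivity)]

variable {R : Type*} [CommRing R] {M : Type*} [AddCommGroup M] [Module R M] {d : ℕ}

theorem sum_risingBinomial_eval_natCast (e : Fin (d + 1) → ℤ) (n : ℕ) :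
    (∑ i : Fin (d + 1), C ((-1 : ℚ) ^ (i : ℕ) * (e i : ℚ)) * risingBinomial (d - (i : ℕ))).eval
        (n : ℚ) =
      (∑ k ∈ Finset.range (d + 1),
        ((-1) ^ (d - k) * e (Fin.ofNat (d + 1) (d - k))) * (n.multichoose k : ℤ) : ℤ) := by
  rw [eval_finsetSum, ← Finset.sum_range_reflect, ← Fin.sum_univ_eq_sum_range
    (fun j => (-1) ^ (d - (d + 1 - 1 - j)) * e (Fin.ofNat (d + 1) (d - (d + 1 - 1 - j))) *
      (n.multichoose (d + 1 - 1 - j) : ℤ))]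
  rw [Int.cast_sum]
  refine Finset.sum_congr rfl fun i _ => ?_
  have hi : d - (d + 1 - 1 - (i : ℕ)) = i := by omega
  have hi' : Fin.ofNat (d + 1) (i : ℕ) = i := by simp
  have hi'' : d + 1 - 1 - (i : ℕ) = d - i := by omega
  rw [hi, hi', hi'', eval_mul, eval_C, risingBinomial_eval_natCast]
  simp

theorem areHilbertCoefficients_iff {I : Ideal R} {f : ℕ → ℤ}
    (hf0 : ∀ n, 0 ≤ f n) (hf : ∀ n, hilbertFunction I M n = ((f n).toNat : ℕ∞))
    (e : Fin (d + 1) → ℤ) :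
    AreHilbertCoefficients I M e ↔ ∀ᶠ n : ℕ in atTop, f n = ∑ k ∈ Finset.range (d + 1),
      ((-1) ^ (d - k) * e (Fin.ofNat (d + 1) (d - k))) * (n.multichoose k : ℤ) := by
  refine eventually_congr (Eventually.of_forall fun n => ?_)
  rw [sum_risingBinomial_eval_natCast, hf]
  constructor
  · rintro ⟨l, h1, h2⟩
    have h1 : (f n).toNat = l := by exact_mod_cast h1
    have h2 := (Int.cast_inj (α := ℚ)).1 (h2.trans (Int.cast_natCast l).symm)
    have := hf0 n
    omega
  · intro h
    refine ⟨(f n).toNat, rfl, ?_⟩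
    rw [← h, ← Int.cast_natCast, Int.toNat_of_nonneg (hf0 n)]

end HilbertCoefficients

theorem mainTheorem3 {R : Type*} [CommRing R] [IsLocalRing R] [IsNoetherianRing R]
    {M : Type*} [AddCommGroup M] [Module R M] [Module.Finite R M]
    (d : ℕ) (hd : 1 ≤ d) (hdim : Module.supportDim R M = d)
    (J : Ideal R)
    (hJ : ∃ x : Fin d → R, IsSystemOfParameters M x ∧ J = Ideal.span (Set.range x)) :
    (∃! e : Fin (d + 1) → ℤ, AreHilbertCoefficients J M e) ∧
      ∀ e : Fin (d + 1) → ℤ, AreHilbertCoefficients J M e → e ⟨1, by omega⟩ ≤ 0 := by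
  obtain ⟨x, hx, rfl⟩ := hJ
  obtain ⟨d, rfl⟩ := Nat.exists_eq_add_of_le' hd
  obtain ⟨l, hl, hlen⟩ := exists_antitone_hilbertFunction_eq_sum x hx.length_ne_top
  set f : ℕ → ℤ := simplexSum fun a => (l a : ℤ) with hfdef
  have hf0 (n) : 0 ≤ f n := simplexSum_nonneg (fun a => Int.natCast_nonneg _) n
  have hf (n) : hilbertFunction (Ideal.span (Set.range x)) M n = ((f n).toNat : ℕ∞) := by
    rw [hlen, hfdef, simplexSum]
    norm_cast
  obtain ⟨c, hc0, hc⟩ := exists_simplexSum_eq_of_antitone (l := fun a => (l a : ℤ))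
    (fun a b hab => Int.ofNat_le.2 (hl hab)) (fun a => Int.natCast_nonneg _)
  have hcoeff (e : Fin (d + 1 + 1) → ℤ) :
      AreHilbertCoefficients (Ideal.span (Set.range x)) M e ↔
        ∀ i : Fin (d + 1 + 1), e i = (-1) ^ (i : ℕ) * c (d + 1 - i) := by
    rw [areHilbertCoefficients_iff hf0 hf]
    constructor
    · intro he i
      have h := eventually_sum_multichoose_injective he hc (d + 1 - i) (by omega)
      have hi : d + 1 - (d + 1 - (i : ℕ)) = i := by omega
      have hi' : Fin.ofNat (d + 1 + 1) (i : ℕ) = i := by simp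
      simp only [hi, hi'] at h
      rw [← h, ← mul_assoc, ← mul_pow]
      simp
    · intro he
      filter_upwards [hc] with n hn
      refine hn.trans (Finset.sum_congr rfl fun k hk => ?_)
      have hk : k < d + 1 + 1 := Finset.mem_range.1 hk
      have hv : ((Fin.ofNat (d + 1 + 1) (d + 1 - k) : Fin (d + 1 + 1)) : ℕ) = d + 1 - k :=
        Nat.mod_eq_of_lt (by omega)
      have hk' : d + 1 - (d + 1 - k) = k := by omega
      rw [he, hv, hk', ← mul_assoc, ← mul_pow]
      simp
  refine ⟨⟨fun i => (-1) ^ (i : ℕ) * c (d + 1 - i), (hcoeff _).2 fun _ => rfl,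
    fun e he => funext ((hcoeff e).1 he)⟩, fun e he => ?_⟩
  rw [(hcoeff e).1 he]
  -- Here `e₁ = -c d`, with `d + 1` the dimension.
  simpa using hc0
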